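/- Let $d\ge 2$, let $\|\cdot\|$ be the Euclidean norm on $\mathbb{R}^d$ and let $\mathbb{S}^{d-1}=\{x\in\mathbb{R}^d : \|x\|=1\}$. Let $g:\mathbb{R}^d\to\mathbb{R}^d$ be continuous and linearly homogeneous, i.e. $g(\alpha x)=\alpha g(x)$ for all $x\in\mathbb{R}^d$ and all $\alpha\ge 0$ (so $g(0)=0$), and suppose that $g(x)=0$ only for $x=0$. Define $D:\mathbb{S}^{d-1}\to(0,\infty)$ and $G:\mathbb{S}^{d-1}\to\mathbb{S}^{d-1}$ by $D(z)=\|g(z)\|$ and $G(z)=g(z)/\|g(z)\|$, and, for any $G$-invariant Borel probability measure $\mu$ on $\mathbb{S}^{d-1}$, let $\lambda(\mu)=\int_{\mathbb{S}^{d-1}}\ln D\,d\mu$. The fixed point $0$ of $g$ is called Lyapunov stable if for every $\varepsilon>0$ there is $\delta>0$ such that $\|g^n(x)\|<\varepsilon$ for all $x$ with $\|x\|<\delta$ and all $n\ge 0$; it is called asymptotically stable if it is Lyapunov stable and there is $\delta>0$ such that $g^n(x)\to 0$ as $n\to\infty$ for all $x$ with $\|x\|<\delta$. (i) If $\lambda(\mu)<0$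 for every ergodic invariant Borel probability measure $\mu$ of $G$, then $0$ is an asymptotically stable fixed point of $g$. (ii) If $0$ is a Lyapunov stable fixed point of $g$, then $\lambda(\mu)\le 0$ for every ergodic invariant Borel probability measure $\mu$ of $G$. -/

import Mathlib

open Filter Topology MeasureTheory

/-- The fixed point `0` of `F` is Lyapunov stable: orbits starting close to `0` stay close to `0`.
(The condition forces `F 0 = 0`.) -/
def LyapunovStableAtZero {E : Type*} [NormedAddCommGroup E] (F : E → E) : Prop :=
  ∀ ε > 0, ∃ δ > 0, ∀ x ∈ Metric.ball (0 : E) δ, ∀ n : ℕ, F^[n] x ∈ Metric.ball (0 : E) ε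

/-- The fixed point `0` of `F` is asymptotically stable: it is Lyapunov stable, and all orbits
starting in some ball around `0` converge to `0`. -/
def AsymptoticallyStableAtZero {E : Type*} [NormedAddCommGroup E] (F : E → E) : Prop :=
  LyapunovStableAtZero F ∧
    ∃ δ > 0, ∀ x ∈ Metric.ball (0 : E) δ, Tendsto (fun n : ℕ => F^[n] x) atTop (𝓝 0)

/-- `g (α x) = α g x` for all `x` and all real `α ≥ 0`. -/
def LinearlyHomogeneous {E : Type*} [NormedAddCommGroup E] [NormedSpace ℝ E] (g : E → E) : Prop :=
  ∀ (x : E) (α : ℝ), 0 ≤ α → g (α • x) = α • g x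

/-- The dilation `D z = ‖g z‖` on the unit sphere. -/
def sphereDilation {E : Type*} [NormedAddCommGroup E] (g : E → E)
    (z : Metric.sphere (0 : E) 1) : ℝ :=
  ‖g z‖

/-- The rotation `G z = g z / ‖g z‖`, a map of the unit sphere to itself, for a map `g` that
vanishes at most at `0`. -/
noncomputable def sphereMap {E : Type*} [NormedAddCommGroup E] [NormedSpace ℝ E] (g : E → E)
    (hg : ∀ x, g x = 0 → x = 0) (z : Metric.sphere (0 : E) 1) : Metric.sphere (0 : E) 1 :=
  ⟨‖g z‖⁻¹ • g z, by
    have hz : (z : E) ≠ 0 := ne_zero_of_mem_unit_sphere z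
    have h : ‖g z‖ ≠ 0 := norm_ne_zero_iff.2 fun h0 => hz (hg _ h0)
    rw [mem_sphere_zero_iff_norm, norm_smul, norm_inv, norm_norm, inv_mul_cancel₀ h]⟩

/-- The exponent of average dilation `λ(μ) = ∫ ln D dμ`. -/
noncomputable def dilationExponent {E : Type*} [NormedAddCommGroup E] [MeasurableSpace E]
    (g : E → E) (μ : Measure (Metric.sphere (0 : E) 1)) : ℝ :=
  ∫ z, Real.log (sphereDilation g z) ∂μ

/-! Homogeneity makes `log ‖g^[n] z‖`, for `z` on the sphere, a Birkhoff sum of `ln D` along the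
orbit of `z` under `G`. For (i), if no fixed length made these sums negative everywhere, orbit
segments of every length would have nonnegative averages. A weak limit of their empirical measures
would be invariant with `λ ≥ 0`, and an ergodic measure maximising `λ` would contradict the
hypothesis. So some `g^[N]` has norm below `1` on the sphere, hence by compactness and homogeneity
contracts everywhere. For (ii), stability bounds the sums above by a constant, while their integral
is `n * λ(μ)`. -/

section InvariantMeasures

variable {X : Type*} [TopologicalSpace X] [MeasurableSpace X] [BorelSpace X]

/-- Measure-preservation of a probability measure under a continuous map is a weakly closed
condition. -/
theorem isClosed_setOf_measurePreserving [HasOuterApproxClosed X] {f : X → X}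
    (hf : Continuous f) :
    IsClosed {μ : ProbabilityMeasure X | MeasurePreserving f (μ : Measure X) μ} := by
  have h : {μ : ProbabilityMeasure X | MeasurePreserving f (μ : Measure X) μ} =
      {μ | μ.map hf.measurable.aemeasurable = μ} := by
    ext μ
    refine ⟨fun h => Subtype.ext h.map_eq, fun h => ⟨hf.measurable, ?_⟩⟩
    exact congrArg (fun ν : ProbabilityMeasure X => (ν : Measure X)) h
  rw [h]
  exact isClosed_eq (ProbabilityMeasure.continuous_map hf) continuous_id

/-- The integral of a continuous function against invariant probability measures of a continuous
map on a compact space attains its supremum at an ergodic measure. -/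
theorem exists_ergodic_integral_ge [CompactSpace X] [T2Space X] [HasOuterApproxClosed X]
    {f : X → X} (hf : Continuous f) (φ : BoundedContinuousFunction X ℝ)
    {μ₀ : Measure X} [IsProbabilityMeasure μ₀] (hμ₀ : MeasurePreserving f μ₀ μ₀) :
    ∃ μ : Measure X, IsProbabilityMeasure μ ∧ Ergodic f μ ∧ ∫ x, φ x ∂μ₀ ≤ ∫ x, φ x ∂μ := by
  set K : Set (ProbabilityMeasure X) := {μ | MeasurePreserving f (μ : Measure X) μ}
  have hKc : IsCompact K := (isClosed_setOf_measurePreserving hf).isCompact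
  have hint (ψ : BoundedContinuousFunction X ℝ) :
      Continuous fun μ : ProbabilityMeasure X => ∫ x, ψ x ∂(μ : Measure X) :=
    ProbabilityMeasure.continuous_integral_continuousMap ψ
  obtain ⟨μ₁, hμ₁, hmax⟩ := hKc.exists_isMaxOn ⟨⟨μ₀, inferInstance⟩, hμ₀⟩ (hint φ).continuousOn
  have hle : ∀ μ ∈ K, ∫ x, φ x ∂(μ : Measure X) ≤ ∫ x, φ x ∂(μ₁ : Measure X) := fun μ hμ =>
    hmax hμ
  set F : Set (ProbabilityMeasure X) :=
    K ∩ {μ | ∫ x, φ x ∂(μ : Measure X) = ∫ x, φ x ∂(μ₁ : Measure X)}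
  have hFc : IsCompact F := hKc.inter_right (isClosed_eq (hint φ) continuous_const)
  -- Extreme points need a vector space: `Φ` carries measures into a product of lines, which is
  -- locally convex, so the compact image of `F` has an extreme point.
  let Φ : ProbabilityMeasure X → BoundedContinuousFunction X ℝ → ℝ :=
    fun μ ψ => ∫ x, ψ x ∂(μ : Measure X)
  have hΦ : Continuous Φ := continuous_pi hint
  obtain ⟨_, ⟨μ, hμF, rfl⟩, hext⟩ :=
    (hFc.image hΦ).extremePoints_nonempty (Set.Nonempty.image Φ ⟨μ₁, hμ₁, rfl⟩)
  refine ⟨μ, inferInstance, Ergodic.of_mem_extremePoints ⟨⟨hμF.1, inferInstance⟩, ?_⟩, ?_⟩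
  · rintro ν₁ ⟨hν₁, hp₁⟩ ν₂ ⟨hν₂, hp₂⟩ ⟨a, b, ha, hb, hab, hμ⟩
    have ha' : a ≠ ⊤ := ne_top_of_le_ne_top ENNReal.one_ne_top (hab ▸ le_self_add)
    have hb' : b ≠ ⊤ := ne_top_of_le_ne_top ENNReal.one_ne_top (hab ▸ le_add_self)
    have hab' : a.toReal + b.toReal = 1 := by
      rw [← ENNReal.toReal_add ha' hb', hab, ENNReal.toReal_one]
    have ha0 : 0 < a.toReal := ENNReal.toReal_pos ha.ne' ha'
    have hb0 : 0 < b.toReal := ENNReal.toReal_pos hb.ne' hb'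
    have hcomb (ψ : BoundedContinuousFunction X ℝ) :
        a.toReal * ∫ x, ψ x ∂ν₁ + b.toReal * ∫ x, ψ x ∂ν₂ = ∫ x, ψ x ∂(μ : Measure X) := by
      rw [← hμ, integral_add_measure ((ψ.integrable ν₁).smul_measure ha')
        ((ψ.integrable ν₂).smul_measure hb'), integral_smul_measure, integral_smul_measure,
        smul_eq_mul, smul_eq_mul]
    have h₁ : ∫ x, φ x ∂ν₁ ≤ ∫ x, φ x ∂(μ₁ : Measure X) := hle ⟨ν₁, hp₁⟩ hν₁
    have h₂ : ∫ x, φ x ∂ν₂ ≤ ∫ x, φ x ∂(μ₁ : Measure X) := hle ⟨ν₂, hp₂⟩ hν₂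
    have hφ := (hcomb φ).trans hμF.2
    have hM : a.toReal * ∫ x, φ x ∂(μ₁ : Measure X) + b.toReal * ∫ x, φ x ∂(μ₁ : Measure X) =
        ∫ x, φ x ∂(μ₁ : Measure X) := by rw [← add_mul, hab', one_mul]
    -- The maximisers form a face: a weighted mean of two values at most the maximum reaches it only
    -- if both do. So `ν₁` and `ν₂` lie in `F`.
    have e₁ : ∫ x, φ x ∂ν₁ = ∫ x, φ x ∂(μ₁ : Measure X) := by
      refine le_antisymm h₁ (le_of_mul_le_mul_left ?_ ha0)
      linarith [mul_le_mul_of_nonneg_left h₂ hb0.le]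
    have e₂ : ∫ x, φ x ∂ν₂ = ∫ x, φ x ∂(μ₁ : Measure X) := by
      refine le_antisymm h₂ (le_of_mul_le_mul_left ?_ hb0)
      linarith [mul_le_mul_of_nonneg_left h₁ ha0.le]
    have key : Φ ⟨ν₁, hp₁⟩ = Φ μ :=
      hext ⟨⟨ν₁, hp₁⟩, ⟨hν₁, e₁⟩, rfl⟩ ⟨⟨ν₂, hp₂⟩, ⟨hν₂, e₂⟩, rfl⟩
        ⟨a.toReal, b.toReal, ha0, hb0, hab', funext hcomb⟩
    exact ext_of_forall_integral_eq_of_IsFiniteMeasure fun ψ => congrFun key ψ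
  · exact (hle ⟨μ₀, inferInstance⟩ hμ₀).trans hμF.2.ge

/-! ### Empirical measures and their limits -/

/-- The empirical measure of the first `n + 1` points of the orbit of `x`. -/
noncomputable def empiricalMeasure (f : X → X) (n : ℕ) (x : X) : Measure X :=
  ((n + 1 : ℕ) : ENNReal)⁻¹ • ∑ k ∈ Finset.range (n + 1), Measure.dirac (f^[k] x)

instance isProbabilityMeasure_empiricalMeasure (f : X → X) (n : ℕ) (x : X) :
    IsProbabilityMeasure (empiricalMeasure f n x) := by
  refine ⟨?_⟩
  simp only [empiricalMeasure, Measure.smul_apply, Measure.finsetSum_apply, measure_univ,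
    Finset.sum_const, Finset.card_range, nsmul_eq_mul, mul_one, smul_eq_mul]
  exact ENNReal.inv_mul_cancel (by simp) (ENNReal.natCast_ne_top _)

theorem integral_empiricalMeasure [CompactSpace X] (f : X → X) (n : ℕ) (x : X)
    (φ : BoundedContinuousFunction X ℝ) :
    ∫ y, φ y ∂(empiricalMeasure f n x) = birkhoffAverage ℝ f φ (n + 1) x := by
  rw [empiricalMeasure, integral_smul_measure, integral_finsetSum_measure
    fun k _ => φ.integrable _]
  simp [birkhoffAverage, birkhoffSum,
    integral_dirac' _ _ φ.continuous.measurable.stronglyMeasurable, -Nat.cast_add]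

/-- Weak limits of empirical measures along orbit segments of growing length are invariant. -/
theorem exists_invariant_tendsto_empiricalMeasure [CompactSpace X] [T2Space X]
    [HasOuterApproxClosed X] {f : X → X} (hf : Continuous f) (x : ℕ → X) :
    ∃ μ : ProbabilityMeasure X, MeasurePreserving f (μ : Measure X) μ ∧
      ∀ φ : BoundedContinuousFunction X ℝ,
        Tendsto (fun n => birkhoffAverage ℝ f φ (n + 1) (x n)) (hyperfilter ℕ)
          (𝓝 (∫ y, φ y ∂(μ : Measure X))) := by
  let ν : ℕ → ProbabilityMeasure X := fun n => ⟨empiricalMeasure f n (x n), inferInstance⟩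
  -- By compactness the ultrafilter converges, which replaces passing to a subsequence.
  obtain ⟨μ, -, hμ⟩ := isCompact_univ.ultrafilter_le_nhds
    ((hyperfilter ℕ).map ν) (by simp)
  have hlim : ∀ φ : BoundedContinuousFunction X ℝ,
      Tendsto (fun n => birkhoffAverage ℝ f φ (n + 1) (x n)) (hyperfilter ℕ)
        (𝓝 (∫ y, φ y ∂(μ : Measure X))) := by
    intro φ
    have h := ProbabilityMeasure.tendsto_iff_forall_integral_tendsto.1
      (show Tendsto ν (hyperfilter ℕ) (𝓝 μ) from hμ) φ
    simpa only [ν, ProbabilityMeasure.coe_mk, integral_empiricalMeasure] using h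
  refine ⟨μ, ⟨hf.measurable, ?_⟩, hlim⟩
  have := Measure.isProbabilityMeasure_map (μ := (μ : Measure X)) hf.measurable.aemeasurable
  refine ext_of_forall_integral_eq_of_IsFiniteMeasure fun φ => ?_
  rw [integral_map hf.measurable.aemeasurable φ.continuous.aestronglyMeasurable]
  have h₁ := hlim (φ.compContinuous ⟨f, hf⟩)
  have h₂ := hlim φ
  -- The two sums telescope to a pair of boundary terms, so the averages differ by at most `2 * ‖φ‖
  -- / (n + 1)`.
  have h₃ : Tendsto (fun n => birkhoffAverage ℝ f (φ.compContinuous ⟨f, hf⟩) (n + 1) (x n) -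
      birkhoffAverage ℝ f φ (n + 1) (x n)) (hyperfilter ℕ) (𝓝 0) := by
    refine Tendsto.mono_left ?_ Nat.hyperfilter_le_atTop
    have hb : Tendsto (fun n : ℕ => (1 / ((n : ℝ) + 1)) * (2 * ‖φ‖)) atTop (𝓝 0) := by
      simpa using tendsto_one_div_add_atTop_nhds_zero_nat.mul_const (2 * ‖φ‖)
    refine squeeze_zero_norm (fun n => ?_) hb
    have e : birkhoffAverage ℝ f (φ.compContinuous ⟨f, hf⟩) (n + 1) (x n) =
        birkhoffAverage ℝ f φ (n + 1) (f (x n)) := by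
      refine congrArg (_ • ·) (Finset.sum_congr rfl fun k _ => congrArg φ ?_)
      exact (Function.iterate_succ_apply' f k (x n)).symm
    rw [e, birkhoffAverage_apply_sub_birkhoffAverage, norm_smul, norm_inv, Real.norm_natCast,
      one_div, Nat.cast_succ]
    gcongr
    exact (dist_eq_norm _ _).symm.trans_le (φ.dist_le_two_norm _ _)
  exact sub_eq_zero.1 (tendsto_nhds_unique (h₁.sub h₂) h₃)

/-- If a continuous observable has negative mean for all ergodic measures, then its Birkhoff sums
of some fixed length are negative everywhere. -/
theorem exists_birkhoffSum_neg [CompactSpace X] [T2Space X] [HasOuterApproxClosed X]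
    {f : X → X} (hf : Continuous f) (φ : BoundedContinuousFunction X ℝ)
    (hφ : ∀ μ : Measure X, IsProbabilityMeasure μ → Ergodic f μ → ∫ x, φ x ∂μ < 0) :
    ∃ n, 0 < n ∧ ∀ x, birkhoffSum f φ n x < 0 := by
  by_contra! H
  choose x hx using fun n : ℕ => H (n + 1) n.succ_pos
  obtain ⟨μ, hμ, hlim⟩ := exists_invariant_tendsto_empiricalMeasure hf x
  obtain ⟨ν, hν, hνe, hle⟩ := exists_ergodic_integral_ge hf φ hμ
  refine (hφ ν hν hνe).not_ge (le_trans ?_ hle)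
  exact ge_of_tendsto' (hlim φ) fun n => smul_nonneg (by positivity) (hx n)

end InvariantMeasures

/-! ### Homogeneous maps and their dynamics on the sphere -/

section Homogeneous

variable {E : Type*} [NormedAddCommGroup E] {g : E → E}

theorem sphereDilation_pos (hzero : ∀ x, g x = 0 → x = 0) (z : Metric.sphere (0 : E) 1) :
    0 < sphereDilation g z :=
  norm_pos_iff.2 fun h => ne_zero_of_mem_unit_sphere z (hzero _ h)

theorem continuous_log_sphereDilation (hcont : Continuous g) (hzero : ∀ x, g x = 0 → x = 0) :
    Continuous fun z => Real.log (sphereDilation g z) :=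
  (hcont.comp continuous_subtype_val).norm.log fun z => (sphereDilation_pos hzero z).ne'

/-- A map with linear growth, some iterate of which is a linear contraction towards `0`, has `0` as
an asymptotically stable fixed point. -/
theorem asymptoticallyStableAtZero_of_norm_iterate_le {M r : ℝ} {N : ℕ} (hM : 1 ≤ M)
    (hgM : ∀ x, ‖g x‖ ≤ M * ‖x‖) (hN : 0 < N) (hr0 : 0 ≤ r) (hr1 : r < 1)
    (hgr : ∀ x, ‖g^[N] x‖ ≤ r * ‖x‖) : AsymptoticallyStableAtZero g := by
  have hM0 : 0 ≤ M := zero_le_one.trans hM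
  have h₁ (k : ℕ) (x : E) : ‖g^[k] x‖ ≤ M ^ k * ‖x‖ := by
    induction k with
    | zero => simp
    | succ k ih =>
      rw [Function.iterate_succ_apply', pow_succ', mul_assoc]
      exact (hgM _).trans (mul_le_mul_of_nonneg_left ih hM0)
  have h₂ (k : ℕ) (x : E) : ‖(g^[N])^[k] x‖ ≤ r ^ k * ‖x‖ := by
    induction k with
    | zero => simp
    | succ k ih =>
      rw [Function.iterate_succ_apply', pow_succ', mul_assoc]
      exact (hgr _).trans (mul_le_mul_of_nonneg_left ih hr0)
  -- Split `n` into `n / N` contracting blocks and a remainder shorter than `N`, whose growth is at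
  -- most `M ^ N` because `M ≥ 1`.
  have h₃ (n : ℕ) (x : E) : ‖g^[n] x‖ ≤ M ^ N * (r ^ (n / N) * ‖x‖) := by
    calc ‖g^[n] x‖ = ‖g^[n % N] ((g^[N])^[n / N] x)‖ := by
          rw [← Function.iterate_mul, ← Function.iterate_add_apply, Nat.mod_add_div]
      _ ≤ M ^ (n % N) * (r ^ (n / N) * ‖x‖) :=
          (h₁ _ _).trans (mul_le_mul_of_nonneg_left (h₂ _ _) (by positivity))
      _ ≤ M ^ N * (r ^ (n / N) * ‖x‖) := by
          gcongr
          exact (Nat.mod_lt n hN).le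
  refine ⟨fun ε hε => ⟨ε / M ^ N, by positivity, fun x hx n => ?_⟩, 1, one_pos, fun x _ => ?_⟩
  · rw [mem_ball_zero_iff] at hx ⊢
    rw [lt_div_iff₀' (by positivity)] at hx
    refine (h₃ n x).trans_lt (lt_of_le_of_lt ?_ hx)
    gcongr
    exact mul_le_of_le_one_left (norm_nonneg x) (pow_le_one₀ hr0 hr1.le)
  · refine squeeze_zero_norm (h₃ · x) ?_
    have := (tendsto_pow_atTop_nhds_zero_of_lt_one hr0 hr1).comp
      (Nat.tendsto_div_const_atTop hN.ne')
    simpa using (this.mul_const ‖x‖).const_mul (M ^ N)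

variable [NormedSpace ℝ E]

theorem LinearlyHomogeneous.iterate (hhom : LinearlyHomogeneous g) (n : ℕ) :
    LinearlyHomogeneous g^[n] := by
  intro x α hα
  induction n with
  | zero => rfl
  | succ n ih => rw [Function.iterate_succ_apply', ih, hhom _ _ hα, Function.iterate_succ_apply']

/-- A bound of a homogeneous map on the unit sphere is a bound of its dilation everywhere. -/
theorem LinearlyHomogeneous.norm_le_mul_norm (hhom : LinearlyHomogeneous g) {r : ℝ}
    (hr : ∀ z : Metric.sphere (0 : E) 1, ‖g z‖ ≤ r) (x : E) : ‖g x‖ ≤ r * ‖x‖ := by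
  rcases eq_or_ne x 0 with rfl | hx
  · have h := hhom 0 0 le_rfl
    rw [zero_smul, zero_smul] at h
    simp [h]
  · have hx' : ‖x‖ ≠ 0 := norm_ne_zero_iff.2 hx
    have hz : ‖x‖⁻¹ • x ∈ Metric.sphere (0 : E) 1 := by
      rw [mem_sphere_zero_iff_norm, norm_smul, norm_inv, norm_norm, inv_mul_cancel₀ hx']
    calc ‖g x‖ = ‖g (‖x‖ • ‖x‖⁻¹ • x)‖ := by rw [smul_inv_smul₀ hx']
      _ = ‖x‖ * ‖g (‖x‖⁻¹ • x)‖ := by rw [hhom _ _ (norm_nonneg x), norm_smul, norm_norm]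
      _ ≤ ‖x‖ * r := by gcongr; exact hr ⟨_, hz⟩
      _ = r * ‖x‖ := mul_comm _ _

theorem continuous_sphereMap (hcont : Continuous g) (hzero : ∀ x, g x = 0 → x = 0) :
    Continuous (sphereMap g hzero) := by
  have h : Continuous fun z : Metric.sphere (0 : E) 1 => g z := hcont.comp continuous_subtype_val
  exact ((h.norm.inv₀ fun z => (sphereDilation_pos hzero z).ne').smul h).subtype_mk _

/-- Polar decomposition of the orbit of a unit vector under a homogeneous map. -/
theorem iterate_eq_exp_birkhoffSum_smul (hhom : LinearlyHomogeneous g)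
    (hzero : ∀ x, g x = 0 → x = 0) (n : ℕ) (z : Metric.sphere (0 : E) 1) :
    g^[n] (z : E) = Real.exp (birkhoffSum (sphereMap g hzero)
      (fun z => Real.log (sphereDilation g z)) n z) • ((sphereMap g hzero)^[n] z : E) := by
  induction n with
  | zero => simp
  | succ n ih =>
    have hpos := sphereDilation_pos hzero ((sphereMap g hzero)^[n] z)
    rw [Function.iterate_succ_apply', ih, hhom _ _ (Real.exp_pos _).le, birkhoffSum_succ,
      Real.exp_add, Real.exp_log hpos, mul_smul, Function.iterate_succ_apply']
    congr 1
    exact (smul_inv_smul₀ hpos.ne' _).symm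

theorem norm_iterate_eq_exp_birkhoffSum (hhom : LinearlyHomogeneous g)
    (hzero : ∀ x, g x = 0 → x = 0) (n : ℕ) (z : Metric.sphere (0 : E) 1) :
    ‖g^[n] (z : E)‖ = Real.exp (birkhoffSum (sphereMap g hzero)
      (fun z => Real.log (sphereDilation g z)) n z) := by
  rw [iterate_eq_exp_birkhoffSum_smul hhom hzero, norm_smul, Real.norm_eq_abs, Real.abs_exp,
    norm_eq_of_mem_sphere, mul_one]

theorem asymptoticallyStableAtZero_of_dilationExponent_neg [ProperSpace E] [MeasurableSpace E]
    [BorelSpace E] (hcont : Continuous g) (hhom : LinearlyHomogeneous g)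
    (hzero : ∀ x, g x = 0 → x = 0)
    (hneg : ∀ μ : Measure (Metric.sphere (0 : E) 1), IsProbabilityMeasure μ →
      Ergodic (sphereMap g hzero) μ → dilationExponent g μ < 0) :
    AsymptoticallyStableAtZero g := by
  have : CompactSpace (Metric.sphere (0 : E) 1) :=
    isCompact_iff_compactSpace.1 (isCompact_sphere 0 1)
  obtain ⟨N, hN, hlt⟩ := exists_birkhoffSum_neg (continuous_sphereMap hcont hzero)
    (BoundedContinuousFunction.mkOfCompact ⟨_, continuous_log_sphereDilation hcont hzero⟩) hneg
  have hbound {f : E → E} (hf : Continuous f) {s : ℝ} (hs : ∀ z : Metric.sphere (0 : E) 1,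
      ‖f z‖ < s) (hs0 : 0 < s) : ∃ r, 0 ≤ r ∧ r < s ∧ ∀ z : Metric.sphere (0 : E) 1, ‖f z‖ ≤ r := by
    rcases isEmpty_or_nonempty (Metric.sphere (0 : E) 1) with h | h
    -- The sphere is empty when `E` is trivial; otherwise `r` is the attained maximum, hence still
    -- below `s`.
    · exact ⟨0, le_rfl, hs0, fun z => h.elim z⟩
    · obtain ⟨z, -, hz⟩ := isCompact_univ.exists_isMaxOn Set.univ_nonempty
        (hf.comp (continuous_subtype_val (p := (· ∈ Metric.sphere (0 : E) 1)))).norm.continuousOn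
      exact ⟨_, norm_nonneg _, hs z, fun w => hz (Set.mem_univ w)⟩
  obtain ⟨r, hr0, hr1, hr⟩ := hbound (hcont.iterate N) (fun z => by
    rw [norm_iterate_eq_exp_birkhoffSum hhom hzero, Real.exp_lt_one_iff]
    exact hlt z) one_pos
  obtain ⟨M, hM⟩ := (isCompact_sphere (0 : E) 1).exists_bound_of_continuousOn hcont.continuousOn
  exact asymptoticallyStableAtZero_of_norm_iterate_le (le_max_right M 1)
    (hhom.norm_le_mul_norm fun z => (hM z z.2).trans (le_max_left M 1)) hN hr0 hr1
    ((hhom.iterate N).norm_le_mul_norm hr)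

/-- Orbits of the unit sphere under a homogeneous map with stable fixed point `0` are uniformly
bounded. -/
theorem LyapunovStableAtZero.exists_norm_iterate_le (hhom : LinearlyHomogeneous g)
    (hstab : LyapunovStableAtZero g) :
    ∃ C, ∀ (n : ℕ) (z : Metric.sphere (0 : E) 1), ‖g^[n] z‖ ≤ C := by
  obtain ⟨δ, hδ, h⟩ := hstab 1 one_pos
  -- Rescaling the unit sphere to radius `δ / 2` puts it inside the open ball of radius `δ`.
  refine ⟨(δ / 2)⁻¹, fun n z => ?_⟩
  have hz : (δ / 2) • (z : E) ∈ Metric.ball (0 : E) δ := by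
    rw [mem_ball_zero_iff, norm_smul, norm_eq_of_mem_sphere, Real.norm_of_nonneg (by positivity)]
    linarith
  have := h _ hz n
  rw [hhom.iterate n _ _ (by positivity), mem_ball_zero_iff, norm_smul,
    Real.norm_of_nonneg (by positivity)] at this
  rw [← one_div, le_div_iff₀' (by positivity)]
  exact this.le

theorem MeasureTheory.MeasurePreserving.integral_birkhoffSum {X : Type*} [MeasurableSpace X]
    {μ : Measure X} {f : X → X} (hf : MeasurePreserving f μ μ) {φ : X → ℝ}
    (hφ : Integrable φ μ) (n : ℕ) : ∫ x, birkhoffSum f φ n x ∂μ = n * ∫ x, φ x ∂μ := by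
  have hk (k : ℕ) : ∫ x, φ (f^[k] x) ∂μ = ∫ x, φ x ∂μ := by
    have h := hf.iterate k
    rw [← integral_map h.measurable.aemeasurable (h.map_eq.symm ▸ hφ.aestronglyMeasurable),
      h.map_eq]
  have hs := integral_finsetSum (Finset.range n) fun k _ =>
    (hf.iterate k).integrable_comp_of_integrable hφ
  simpa [birkhoffSum, hk] using hs

/-- Invariance suffices: `n * λ(μ) ≤ log C` for all `n`, with `C` independent of `n`, excludes `λ(μ)
> 0`. -/
theorem dilationExponent_nonpos_of_lyapunovStableAtZero [ProperSpace E] [MeasurableSpace E]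
    [BorelSpace E] (hcont : Continuous g) (hhom : LinearlyHomogeneous g)
    (hzero : ∀ x, g x = 0 → x = 0) (hstab : LyapunovStableAtZero g)
    {μ : Measure (Metric.sphere (0 : E) 1)} [IsProbabilityMeasure μ]
    (hμ : MeasurePreserving (sphereMap g hzero) μ μ) : dilationExponent g μ ≤ 0 := by
  have : CompactSpace (Metric.sphere (0 : E) 1) :=
    isCompact_iff_compactSpace.1 (isCompact_sphere 0 1)
  obtain ⟨C, hC⟩ := hstab.exists_norm_iterate_le hhom
  have hcl := continuous_log_sphereDilation hcont hzero
  have hint : Integrable (fun z => Real.log (sphereDilation g z)) μ :=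
    (BoundedContinuousFunction.mkOfCompact ⟨_, hcl⟩).integrable μ
  have hle (n : ℕ) : n * dilationExponent g μ ≤ Real.log C := by
    rw [dilationExponent, ← hμ.integral_birkhoffSum hint]
    have hsum : Integrable (birkhoffSum (sphereMap g hzero)
        (fun z => Real.log (sphereDilation g z)) n) μ :=
      integrable_finsetSum _ fun k _ => (hμ.iterate k).integrable_comp_of_integrable hint
    calc _ ≤ ∫ _, Real.log C ∂μ := integral_mono hsum (integrable_const _) fun z => by
          have h := hC n z
          rw [norm_iterate_eq_exp_birkhoffSum hhom hzero] at h
          exact (Real.le_log_iff_exp_le ((Real.exp_pos _).trans_le h)).2 h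
      _ = Real.log C := by simp
  by_contra! hpos
  obtain ⟨n, hn⟩ := exists_nat_gt (Real.log C / dilationExponent g μ)
  rw [div_lt_iff₀ hpos] at hn
  exact (hle n).not_gt hn

end Homogeneous

theorem theorem4p2 (d : ℕ) (hd : 2 ≤ d)
    (g : EuclideanSpace ℝ (Fin d) → EuclideanSpace ℝ (Fin d))
    (hcont : Continuous g) (hhom : LinearlyHomogeneous g) (hzero : ∀ x, g x = 0 → x = 0) :
    ((∀ μ : Measure (Metric.sphere (0 : EuclideanSpace ℝ (Fin d)) 1), IsProbabilityMeasure μ →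
        Ergodic (sphereMap g hzero) μ → dilationExponent g μ < 0) →
      AsymptoticallyStableAtZero g) ∧
    (LyapunovStableAtZero g →
      ∀ μ : Measure (Metric.sphere (0 : EuclideanSpace ℝ (Fin d)) 1), IsProbabilityMeasure μ →
        Ergodic (sphereMap g hzero) μ → dilationExponent g μ ≤ 0) := by
  exact ⟨asymptoticallyStableAtZero_of_dilationExponent_neg hcont hhom hzero,
    fun hstab μ _ hμ => dilationExponent_nonpos_of_lyapunovStableAtZero hcont hhom hzero hstab
      hμ.toMeasurePreserving⟩
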